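/- A \emph{Streett automaton with costs} $\mathcal A=(Q,\Sigma,q_I,\delta,(Q_j,P_j)_{j\in J},(\mathrm{Cst}_j)_{j\in J})$ has a finite state set $Q$, a finite alphabet $\Sigma$, an initial state $q_I$, a complete deterministic transition function $\delta\colon Q\times\Sigma\to Q$, finitely many pairs of sets $Q_j,P_j\subseteq Q$ (requests and responses), and for each $j\in J$ a function $\mathrm{Cst}_j$ that labels every transition as an $\epsilon$- or an increment-transition. Its size is $|Q|+|J|$. For the run $\rho=(q_0,a_0,q_1)(q_1,a_1,q_2)\cdots$ on an infinite word (starting in $q_0=q_I$), the cost-of-response $\mathrm{StCor}_j(\rho,m)$ is $0$ if $q_m\notin Q_j$, and otherwise the minimum, over all $m'\ge m$ with $q_{m'}\in P_j$, of the number of increment-transitions with respect to $\mathrm{Cst}_j$ between positions $m$ and $m'$ ($\min\emptyset=\infty$). The cost of $\rho$ is $\limsup_{m\to\infty}\max_{j\in J}\mathrm{StCor}_j(\rho,m)$, and $L(\mathcal A)$ is the set of infinite words whose run has finite cost. A \emph{delay function} is a map $f\colon\mathbb N\to\mathbb N\setminus\{0\}$. In the delay game $\Gamma_f(L)$ with $L\subseteq(\Sigma_I\times\Sigma_O)^\omega$,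 in each round $i=0,1,2,\dots$ Player $I$ picks $u_i\in\Sigma_I^{f(i)}$ and then Player $O$ picks $v_i\in\Sigma_O$; Player $O$ wins if ${u_0u_1u_2\cdots\choose v_0v_1v_2\cdots}\in L$. A strategy for Player $O$ is a map $\tau_O\colon\Sigma_I^*\to\Sigma_O$, used by playing $v_i=\tau_O(u_0\cdots u_i)$; it is winning if all its outcomes are in $L$. For $L=L(\mathcal A)$, its cost $\mathrm{Cst}(\tau_O)\in\mathbb N\cup\{\infty\}$ is the supremum of the costs of the runs of $\mathcal A$ on its outcomes. The function $f$ \emph{eventually grants a lookahead of size $m$} if there is an $i$ with $\sum_{0\le i'\le i}(f(i')-1)\ge m$. \textbf{Theorem.} There are finite alphabets $\Sigma_I,\Sigma_O$ and a polynomial $p$ such that for every $n>0$ there is a language $L_n\subseteq(\Sigma_I\times\Sigma_O)^\omega$ recognized by a Streett automaton with costs $\mathcal A_n$ of size at most $p(n)$ such that \begin{itemize} \item Player $O$ has a winning strategy $\tau_O$ for $\Gamma_f(L_n)$ for some delay function $f$ with $\mathrm{Cst}(\tau_O)=n$; \item for every delay function $f$, if Player $O$ has a winning strategy $\tau_O$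 for $\Gamma_f(L_n)$ with $\mathrm{Cst}(\tau_O)=n$, then $f$ eventually grants a lookahead of size $n\cdot(2^{2^n}-1)$; \item for every delay function $f$, every winning strategy for Player $O$ in $\Gamma_f(L_n)$ has cost at least $n$. \end{itemize} Hence strategies that are optimal with respect to all delay functions may need doubly-exponential lookahead. -/

import Mathlib

open Filter

/-- The label of a transition under a cost function: `eps` for an epsilon-transition, `inc` for an
increment-transition. -/
inductive CostLabel
  | eps
  | inc

/-- The contribution of a transition to the cost of a run. -/
def CostLabel.val : CostLabel → ℕ
  | eps => 0
  | inc => 1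

/-- A (deterministic and complete) Streett automaton with costs, with states `Q`, alphabet `S` and
Streett pairs `(request j, response j)` for `j : J`. The transition relation is the graph of `step`,
so a cost function on transitions is a function of the source state and the letter read. -/
structure StreettAutomaton (Q S J : Type) where
  init : Q
  step : Q → S → Q
  request : J → Set Q
  response : J → Set Q
  cost : J → Q → S → CostLabel

namespace StreettAutomaton

variable {Q S J : Type}

/-- The size: number of states plus number of Streett pairs. -/
def size [Fintype Q] [Fintype J] (_ : StreettAutomaton Q S J) : ℕ :=
  Fintype.card Q + Fintype.card J

/-- The state reached after the first `n` letters in the run on the infinite word `w`. -/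
def run (M : StreettAutomaton Q S J) (w : ℕ → S) : ℕ → Q
  | 0 => M.init
  | n + 1 => M.step (M.run w n) (w n)

/-- The number of increment-transitions with respect to pair `j` in the part of the run on `w`
from position `n` to position `n'`. -/
def segmentCost (M : StreettAutomaton Q S J) (w : ℕ → S) (j : J) (n n' : ℕ) : ℕ :=
  ∑ k ∈ Finset.Ico n n', (M.cost j (M.run w k) (w k)).val

open Classical in
/-- The cost-of-response of pair `j` at position `n` of the run on `w`: it is `0` if there is no
request at `n`, and otherwise the least cost of reaching a response (infinite if there is none). -/
noncomputable def costOfResponse (M : StreettAutomaton Q S J) (w : ℕ → S) (j : J) (n : ℕ) : ℕ∞ :=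
  if M.run w n ∈ M.request j then
    ⨅ (n' : ℕ) (_ : n ≤ n') (_ : M.run w n' ∈ M.response j), (M.segmentCost w j n n' : ℕ∞)
  else 0

/-- The maximum of the costs-of-response at position `n` over all pairs. -/
noncomputable def maxCostOfResponse (M : StreettAutomaton Q S J) (w : ℕ → S) (n : ℕ) : ℕ∞ :=
  ⨆ j : J, M.costOfResponse w j n

/-- The cost of the run on `w`. -/
noncomputable def runCost (M : StreettAutomaton Q S J) (w : ℕ → S) : ℕ∞ :=
  limsup (fun n => M.maxCostOfResponse w n) atTop

/-- The language of the automaton: the infinite words whose run has finite cost. -/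
def language (M : StreettAutomaton Q S J) : Set (ℕ → S) :=
  {w | M.runCost w < ⊤}

end StreettAutomaton

/-- Delay functions are maps from the natural numbers to the positive natural numbers. -/
def IsDelayFunction (f : ℕ → ℕ) : Prop := ∀ i, 0 < f i

/-- The delay function `f` eventually grants a lookahead of size `m`. -/
def EventuallyGrants (f : ℕ → ℕ) (m : ℕ) : Prop :=
  ∃ i, m ≤ ∑ i' ∈ Finset.range (i + 1), (f i' - 1)

section DelayGame

variable {A B : Type}

/-- In the delay game with delay function `f`, Player I picks in round `i` a word `u i` of length
`f i`. If the moves of Player I yield the infinite word `α = u 0 ++ u 1 ++ ⋯`, then this is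
`u 0 ++ ⋯ ++ u i`, the input available to Player O when she moves in round `i`. -/
def inputUpTo (f : ℕ → ℕ) (α : ℕ → A) (i : ℕ) : List A :=
  List.ofFn fun k : Fin (∑ i' ∈ Finset.range (i + 1), f i') => α k

/-- The move `u i` of Player I in round `i`, if his moves yield the infinite word `α`. -/
def inputMove (f : ℕ → ℕ) (α : ℕ → A) (i : ℕ) : List A :=
  List.ofFn fun k : Fin (f i) => α ((∑ i' ∈ Finset.range i, f i') + k)

/-- The input available in round `i` is the concatenation of the first `i + 1` moves. -/
theorem inputUpTo_eq_flatMap (f : ℕ → ℕ) (α : ℕ → A) (i : ℕ) :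
    inputUpTo f α i = (List.range (i + 1)).flatMap (inputMove f α) := by
  induction i with
  | zero =>
    apply List.ext_getElem
    · simp [inputUpTo, inputMove]
    · intro k h1 h2
      simp [inputUpTo, inputMove]
      rfl
  | succ i ih =>
    rw [List.range_succ, List.flatMap_append, ← ih]
    apply List.ext_getElem
    · simp [inputUpTo, inputMove, Finset.sum_range_succ]
    · intro k h1 h2
      simp only [inputUpTo, inputMove, List.flatMap_cons, List.flatMap_nil, List.append_nil,
        List.getElem_ofFn, List.getElem_append, List.length_ofFn]
      split
      · rfl
      · congr 1; omega

/-- A strategy for Player O maps finite words over the input alphabet to output letters. The set of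
outcomes of `τ` in the delay game with delay function `f` consists of the words resulting from the
plays that are consistent with `τ`, i.e., those in which the letter picked by Player O in round `i`
is `τ (u 0 ++ ⋯ ++ u i)`. -/
def outcomes (f : ℕ → ℕ) (τ : List A → B) : Set (ℕ → A × B) :=
  {w | ∀ i, (w i).2 = τ (inputUpTo f (fun k => (w k).1) i)}

/-- `τ` is a winning strategy for Player O in the delay game with delay function `f` and winning
condition `L`. -/
def IsWinningO (f : ℕ → ℕ) (L : Set (ℕ → A × B)) (τ : List A → B) : Prop :=
  ∀ w ∈ outcomes f τ, w ∈ L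

/-- The cost of a strategy for Player O: the supremum of the costs of the runs on its outcomes. -/
noncomputable def strategyCost {Q J : Type} (M : StreettAutomaton Q (A × B) J) (f : ℕ → ℕ)
    (τ : List A → B) : ℕ∞ :=
  ⨆ w ∈ outcomes f τ, M.runCost w

end DelayGame

/-! Input and output are read in blocks of `n + 1` bits, each block a number below `K = 2 ^ (n +
1)`. Player I may open an epoch, in which Player O claims a number `j`; as long as she keeps `j`,
the epoch closes only when the input, from its opening on, completes a bad `j`-pair. Winning
requires infinitely many idle blocks. Each claimed bit of an epoch must be repeated one block later,
and a block contains `n` increments, so keeping a claim costs `n` while changing it inside an epoch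
costs at least `2 * n`.

Two facts about sequences of numbers below `K` settle the lookahead. Any `2 ^ K` of them contain a
bad pair (`exists_isBadPair`), so a lookahead of `2 ^ K` blocks lets Player O pick a correct claim
at once and keep it (`exists_optimal`). The 2-adic valuations of `1, …, 2 ^ K - 1` contain none
(`exists_padicValNat_lt`). If Player O commits to `j` seeing only `M < 2 ^ K` blocks, Player I shows
her `M` such valuations and then repeats a number other than `j`, so the epoch cannot close until
she changes her claim (`exists_forced_claimChange`). Iterating this forces cost above `n`; it
applies with `M = 2 ^ 2 ^ n` when the granted lookahead is too small
(`eventuallyGrants_of_strategyCost_eq`). Cost `n` is unavoidable, since Player I can keep signalling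
a start (`le_strategyCost`). -/

namespace BlockGame

/-! ### Blocks of letters -/

/-- The number with binary digits `c s, …, c (s + k - 1)`, most significant digit first. -/
def prefixVal (c : ℕ → Bool) (s : ℕ) : ℕ → ℕ
  | 0 => 0
  | k + 1 => 2 * prefixVal c s k + (c (s + k)).toNat

/-- The number encoded by the block `b` of length `n + 1`. -/
def blockVal (n : ℕ) (c : ℕ → Bool) (b : ℕ) : ℕ := prefixVal c (b * (n + 1)) (n + 1)

theorem prefixVal_congr {c c' : ℕ → Bool} {s k : ℕ} (h : ∀ i < k, c (s + i) = c' (s + i)) :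
    prefixVal c s k = prefixVal c' s k := by
  induction k with
  | zero => rfl
  | succ k ih =>
    simp only [prefixVal]
    rw [ih fun i hi => h i (by omega), h k (by omega)]

theorem prefixVal_lt (c : ℕ → Bool) (s k : ℕ) : prefixVal c s k < 2 ^ k := by
  induction k with
  | zero => simp [prefixVal]
  | succ k ih =>
    have := Bool.toNat_le (c (s + k))
    simp only [prefixVal, pow_succ]
    omega

theorem prefixVal_testBit {c : ℕ → Bool} {s v N : ℕ} (hv : v < 2 ^ N)
    (hc : ∀ i < N, c (s + i) = v.testBit (N - 1 - i)) {k : ℕ} (hk : k ≤ N) :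
    prefixVal c s k = v / 2 ^ (N - k) := by
  induction k with
  | zero => simp [prefixVal, Nat.div_eq_of_lt hv]
  | succ k ih =>
    have h1 : N - k = N - (k + 1) + 1 := by omega
    have h2 : N - 1 - k = N - (k + 1) := by omega
    rw [prefixVal, ih (by omega), hc k (by omega), Nat.toNat_testBit, h1, h2, pow_succ,
      ← Nat.div_div_eq_div_mul]
    omega

theorem blockVal_lt (n : ℕ) (c : ℕ → Bool) (b : ℕ) : blockVal n c b < 2 ^ (n + 1) :=
  prefixVal_lt _ _ _

theorem blockVal_congr {n b : ℕ} {c c' : ℕ → Bool}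
    (h : ∀ i < (b + 1) * (n + 1), c i = c' i) : blockVal n c b = blockVal n c' b :=
  prefixVal_congr fun i hi => h _ (by rw [Nat.succ_mul]; omega)

/-- The word whose block `b` encodes the number `v b`. -/
def encode (n : ℕ) (v : ℕ → ℕ) (i : ℕ) : Bool := (v (i / (n + 1))).testBit (n - i % (n + 1))

theorem blockVal_encode {n : ℕ} {v : ℕ → ℕ} {b : ℕ} (h : v b < 2 ^ (n + 1)) :
    blockVal n (encode n v) b = v b := by
  rw [blockVal, prefixVal_testBit h _ le_rfl]
  · simp
  · intro i hi
    have h1 : (b * (n + 1) + i) / (n + 1) = b := by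
      rw [mul_comm, Nat.mul_add_div (by omega), Nat.div_eq_of_lt hi, add_zero]
    have h2 : (b * (n + 1) + i) % (n + 1) = i := by
      rw [mul_comm, Nat.mul_add_mod, Nat.mod_eq_of_lt hi]
    simp [encode, h1, h2]

/-- With the most significant digit first, earlier digits decide. Hence one `Ordering` is all the
memory the automaton needs to compare two blocks, which keeps it of linear size. -/
theorem compare_prefixVal_step (a b : ℕ) (x y : Bool) :
    compare (2 * a + x.toNat) (2 * b + y.toNat) = (compare a b).then (compare x y) := by
  rcases lt_trichotomy a b with h | h | h
  · rw [compare_lt_iff_lt.2 h, compare_lt_iff_lt.2]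
    · rfl
    · have := Bool.toNat_le x
      omega
  · subst h
    have h0 : compare a a = Ordering.eq := compare_eq_iff_eq.2 rfl
    rw [h0]
    cases x <;> cases y
    · exact compare_eq_iff_eq.2 rfl
    · exact compare_lt_iff_lt.2 (by simp)
    · exact compare_gt_iff_gt.2 (by simp)
    · exact compare_eq_iff_eq.2 rfl
  · rw [compare_gt_iff_gt.2 h, compare_gt_iff_gt.2]
    · rfl
    · have := Bool.toNat_le y
      omega

/-! ### The automaton -/

/-- The mode of the automaton is `none` (idle) or `some seen` (active), where `seen` tells whether
the number claimed by Player O has occurred in the input since the last larger number. The mode is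
updated after each block, given the result of comparing the input to the claimed number. -/
def nextMode : Option Bool → Ordering → Bool → Option Bool
  | none, _, start => if start then some false else none
  | some _, .gt, _ => some false
  | some seen, .lt, _ => some seen
  | some false, .eq, _ => some true
  -- The start signal is ignored here, so an idle block separates any two epochs and the claim can
  -- change between them for free.
  | some true, .eq, _ => none

/-- The mode in the block `b`, for inputs `X`, claims `Y` and start signals `S`. -/
def modes (X Y : ℕ → ℕ) (S : ℕ → Bool) : ℕ → Option Bool
  | 0 => nextMode none .eq (S 0)
  | b + 1 => nextMode (modes X Y S b) (compare (X b) (Y b)) (S (b + 1))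

theorem modes_congr {X Y X' Y' : ℕ → ℕ} {S S' : ℕ → Bool} {b : ℕ}
    (hX : ∀ c < b, X c = X' c) (hY : ∀ c < b, Y c = Y' c) (hS : ∀ c ≤ b, S c = S' c) :
    modes X Y S b = modes X' Y' S' b := by
  induction b with
  | zero => simp [modes, hS 0 le_rfl]
  | succ b ih =>
    simp only [modes]
    rw [ih (fun c hc => hX c (by omega)) (fun c hc => hY c (by omega))
      (fun c hc => hS c (by omega)), hX b (by omega), hY b (by omega), hS _ le_rfl]

/-- The state after reading a letter: the mode, the position in the current block of length `n + 1`,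
the parity of the number of the block, the last output bit, and the result of comparing the input
and output bits of the current block. -/
structure BlockState (n : ℕ) where
  mode : Option Bool
  pos : Fin (n + 1)
  parity : Bool
  bit : Bool
  order : Ordering
  deriving Fintype

/-- An input letter is a bit with a start signal, an output letter is a bit. The pair `none` requires
that the automaton becomes idle infinitely often. The pairs `(k, v, p)` require that an output bit
`v` at position `k` of an active block of parity `p` is repeated in the next block. -/
def automaton (n : ℕ) :
    StreettAutomaton (BlockState n) ((Bool × Bool) × Bool)
      (Option (Fin (n + 1) × Bool × Bool)) where
  -- The initial state poses as the end of an odd block, so that the first letter opens the even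
  -- block `0`.
  init := ⟨none, Fin.last n, true, false, .eq⟩
  step s l :=
    if s.pos = Fin.last n then
      ⟨nextMode s.mode s.order l.1.2, 0, !s.parity, l.2, compare l.1.1 l.2⟩
    else ⟨s.mode, s.pos + 1, s.parity, l.2, s.order.then (compare l.1.1 l.2)⟩
  request
    | none => {s | s.mode ≠ none}
    | some (k, v, p) => {s | s.pos = k ∧ s.parity = p ∧ s.bit = v ∧ s.mode ≠ none}
  response
    | none => {s | s.mode = none}
    -- Without the change of parity, a request would answer itself at cost `0`.
    | some (k, v, p) => {s | s.pos = k ∧ s.parity = !p ∧ (s.mode = none ∨ s.bit = v)}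
  cost
    | none, _, _ => .eps
    | some _, s, _ => if s.pos = Fin.last n then .eps else .inc

theorem size_automaton (n : ℕ) : (automaton n).size ≤ 40 * (n + 1) + 1 := by
  have h : Fintype.card (BlockState n) ≤
      Fintype.card (Option Bool × Fin (n + 1) × Bool × Bool × Ordering) :=
    Fintype.card_le_of_injective (fun s => (s.mode, s.pos, s.parity, s.bit, s.order)) (by
      rintro ⟨⟩ ⟨⟩ h
      simpa using h)
  have h3 : Fintype.card Ordering = 3 := rfl
  simp only [Fintype.card_prod, Fintype.card_option, Fintype.card_bool, Fintype.card_fin, h3] at h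
  simp only [StreettAutomaton.size, Fintype.card_option, Fintype.card_prod, Fintype.card_bool,
    Fintype.card_fin]
  omega

/-- The mode of the automaton in the block `b` of the run on `w`. -/
def modeOf (n : ℕ) (w : ℕ → (Bool × Bool) × Bool) (b : ℕ) : Option Bool :=
  modes (blockVal n fun i => (w i).1.1) (blockVal n fun i => (w i).2)
    (fun c => (w (c * (n + 1))).1.2) b

theorem run_automaton (n : ℕ) (w : ℕ → (Bool × Bool) × Bool) (b k : ℕ) (hk : k < n + 1) :
    (automaton n).run w (b * (n + 1) + k + 1) =
      ⟨modeOf n w b, ⟨k, hk⟩, b.bodd, (w (b * (n + 1) + k)).2,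
        compare (prefixVal (fun i => (w i).1.1) (b * (n + 1)) (k + 1))
          (prefixVal (fun i => (w i).2) (b * (n + 1)) (k + 1))⟩ := by
  have first (x y : Bool) : compare (2 * 0 + x.toNat) (2 * 0 + y.toNat) = compare x y := by
    rw [compare_prefixVal_step]
    rfl
  have inner (b : ℕ) (h0 : (automaton n).run w (b * (n + 1) + 1) =
      ⟨modeOf n w b, 0, b.bodd, (w (b * (n + 1))).2,
        compare (w (b * (n + 1))).1.1 (w (b * (n + 1))).2⟩) (k : ℕ) (hk : k < n + 1) :
      (automaton n).run w (b * (n + 1) + k + 1) =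
      ⟨modeOf n w b, ⟨k, hk⟩, b.bodd, (w (b * (n + 1) + k)).2,
        compare (prefixVal (fun i => (w i).1.1) (b * (n + 1)) (k + 1))
          (prefixVal (fun i => (w i).2) (b * (n + 1)) (k + 1))⟩ := by
    induction k with
    | zero =>
      rw [add_zero, h0]
      simp only [prefixVal, first, add_zero]
      rfl
    | succ k ih =>
      rw [StreettAutomaton.run, ← add_assoc, ih (by omega)]
      have hne : (⟨k, by omega⟩ : Fin (n + 1)) ≠ Fin.last n := by
        intro h
        have := congrArg Fin.val h
        simp at this
        omega
      have hpos : (⟨k, by omega⟩ : Fin (n + 1)) + 1 = ⟨k + 1, hk⟩ := by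
        apply Fin.ext
        rw [Fin.val_add_one_of_lt (Fin.lt_last_iff_ne_last.2 hne)]
      simp only [automaton, if_neg hne, hpos]
      exact congrArg _ (compare_prefixVal_step _ _ _ _).symm
  refine inner b ?_ k hk
  induction b with
  | zero =>
    rw [zero_mul, zero_add, StreettAutomaton.run, StreettAutomaton.run]
    simp [automaton, modeOf, modes]
  | succ b ih =>
    have h1 : (b + 1) * (n + 1) = b * (n + 1) + n + 1 := by ring
    have h2 := inner b ih n (by omega)
    rw [StreettAutomaton.run, h1, h2, ← h1]
    have hlast : (⟨n, by omega⟩ : Fin (n + 1)) = Fin.last n := rfl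
    simp only [automaton, hlast, if_true, Nat.bodd_succ]
    rfl

theorem exists_block (n t : ℕ) : ∃ b k, k < n + 1 ∧ t = b * (n + 1) + k :=
  ⟨t / (n + 1), t % (n + 1), Nat.mod_lt _ (by omega), by
    rw [mul_comm]; exact (Nat.div_add_mod _ _).symm⟩

theorem cost_automaton (n : ℕ) (w : ℕ → (Bool × Bool) × Bool) (j : Fin (n + 1) × Bool × Bool)
    (t : ℕ) : ((automaton n).cost (some j) ((automaton n).run w t) (w t)).val =
      if ¬ (n + 1) ∣ t then 1 else 0 := by
  rcases t with _ | t
  · simp [automaton, StreettAutomaton.run, CostLabel.val]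
  · obtain ⟨b, k, hk, rfl⟩ := exists_block n t
    rw [run_automaton n w b k hk]
    have h : (n + 1) ∣ b * (n + 1) + k + 1 ↔ (⟨k, hk⟩ : Fin (n + 1)) = Fin.last n := by
      rw [add_assoc, Nat.dvd_add_right (Dvd.intro_left b rfl), Fin.ext_iff]
      constructor
      · intro h
        have := Nat.le_of_dvd (by omega) h
        simp
        omega
      · intro h
        simp at h
        rw [h]
    simp only [automaton, h]
    split_ifs <;> simp_all [CostLabel.val]

/-- Among `n + 1` consecutive transitions exactly one leaves the last position of a block, and only
that one is free. -/
theorem segmentCost_block (n : ℕ) (w : ℕ → (Bool × Bool) × Bool) (j : Fin (n + 1) × Bool × Bool)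
    (t : ℕ) : (automaton n).segmentCost w (some j) t (t + (n + 1)) = n := by
  simp only [StreettAutomaton.segmentCost, cost_automaton]
  rw [← Finset.card_filter, Nat.filter_Ico_card_eq_of_periodic _ _ (fun i => ¬ (n + 1) ∣ i)]
  · rw [Nat.count_eq_card_filter_range]
    have : Finset.filter (fun i => ¬ (n + 1) ∣ i) (Finset.range (n + 1)) =
        (Finset.range (n + 1)).erase 0 := by
      ext i
      simp only [Finset.mem_filter, Finset.mem_range, Finset.mem_erase]
      constructor
      · rintro ⟨h1, h2⟩
        exact ⟨by rintro rfl; simp at h2, h1⟩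
      · rintro ⟨h1, h2⟩
        exact ⟨h2, fun h => by have := Nat.le_of_dvd (by omega) h; omega⟩
    rw [this, Finset.card_erase_of_mem (by simp)]
    simp
  · intro i
    simp

theorem segmentCost_mono {Q S J : Type} (M : StreettAutomaton Q S J) (w : ℕ → S) (j : J)
    {t u v : ℕ} (h : u ≤ v) : M.segmentCost w j t u ≤ M.segmentCost w j t v :=
  Finset.sum_le_sum_of_subset (Finset.Ico_subset_Ico le_rfl h)

theorem segmentCost_add {Q S J : Type} (M : StreettAutomaton Q S J) (w : ℕ → S) (j : J)
    {t u v : ℕ} (h : t ≤ u) (h' : u ≤ v) :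
    M.segmentCost w j t u + M.segmentCost w j u v = M.segmentCost w j t v :=
  Finset.sum_Ico_consecutive _ h h'

/-! ### The cost of runs -/

theorem costOfResponse_le {Q S J : Type} (M : StreettAutomaton Q S J) {w : ℕ → S} {j : J}
    {t u : ℕ} (h : t ≤ u) (hu : M.run w u ∈ M.response j) :
    M.costOfResponse w j t ≤ M.segmentCost w j t u := by
  unfold StreettAutomaton.costOfResponse
  split_ifs
  · exact iInf₂_le_of_le u h (iInf_le _ hu)
  · exact zero_le

theorem costOfResponse_le_max {Q S J : Type} (M : StreettAutomaton Q S J) (w : ℕ → S) (j : J)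
    (t : ℕ) : M.costOfResponse w j t ≤ M.maxCostOfResponse w t :=
  le_iSup (fun j => M.costOfResponse w j t) j

theorem le_costOfResponse {Q S J : Type} (M : StreettAutomaton Q S J) {w : ℕ → S} {j : J}
    {t : ℕ} {c : ℕ∞} (ht : M.run w t ∈ M.request j)
    (h : ∀ u, t ≤ u → M.run w u ∈ M.response j → c ≤ M.segmentCost w j t u) :
    c ≤ M.costOfResponse w j t := by
  rw [StreettAutomaton.costOfResponse, if_pos ht]
  exact le_iInf fun u => le_iInf fun h1 => le_iInf fun h2 => h u h1 h2

/-- A response to the request at position `k` of the active block `b` can only occur at the same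
position of a later block of the other parity. -/
theorem exists_block_of_response {n : ℕ} {w : ℕ → (Bool × Bool) × Bool} {b k : ℕ} {v : Bool}
    (hk : k < n + 1) {u : ℕ} (hu : b * (n + 1) + k + 1 ≤ u)
    (h : (automaton n).run w u ∈ (automaton n).response (some (⟨k, hk⟩, v, b.bodd))) :
    ∃ c, u = c * (n + 1) + k + 1 ∧ b < c ∧ c.bodd = !b.bodd ∧
      (modeOf n w c = none ∨ (w (c * (n + 1) + k)).2 = v) := by
  obtain ⟨t, rfl⟩ : ∃ t, u = t + 1 := ⟨u - 1, by omega⟩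
  obtain ⟨c, l, hl, rfl⟩ := exists_block n t
  rw [run_automaton n w c l hl] at h
  simp only [automaton, Set.mem_ofPred_eq, Fin.mk.injEq] at h
  obtain ⟨rfl, h1, h2⟩ := h
  refine ⟨c, rfl, ?_, h1, h2⟩
  have h3 : b ≤ c := Nat.le_of_mul_le_mul_right (by omega : b * (n + 1) ≤ c * (n + 1)) (by omega)
  refine lt_of_le_of_ne h3 ?_
  rintro rfl
  simp at h1

theorem request_of_active {n : ℕ} {w : ℕ → (Bool × Bool) × Bool} {b k : ℕ} (hk : k < n + 1)
    (h : modeOf n w b ≠ none) : (automaton n).run w (b * (n + 1) + k + 1) ∈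
      (automaton n).request (some (⟨k, hk⟩, (w (b * (n + 1) + k)).2, b.bodd)) := by
  rw [run_automaton n w b k hk]
  simp [automaton, h]

/-- By parity, the request at position `0` is answered at the earliest one full block later. -/
theorem le_maxCost_of_active {n : ℕ} {w : ℕ → (Bool × Bool) × Bool} {b : ℕ}
    (h : modeOf n w b ≠ none) :
    (n : ℕ∞) ≤ (automaton n).maxCostOfResponse w (b * (n + 1) + 0 + 1) := by
  refine le_trans (le_costOfResponse _ (request_of_active n.succ_pos h) ?_) (costOfResponse_le_max _ _ _ _)
  intro u hu hr
  obtain ⟨c, rfl, hc, -, -⟩ := exists_block_of_response n.succ_pos hu hr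
  rw [Nat.cast_le]
  have h1 : (b + 1) * (n + 1) ≤ c * (n + 1) := Nat.mul_le_mul_right _ hc
  rw [Nat.succ_mul] at h1
  exact (segmentCost_block n w _ _).ge.trans (segmentCost_mono _ _ _ (by omega))

/-- Changing the claimed number in the middle of an active phase costs more than `n`. -/
theorem lt_maxCost_of_change {n : ℕ} (hn : 0 < n) {w : ℕ → (Bool × Bool) × Bool} {b : ℕ}
    (h : modeOf n w b ≠ none) (h' : modeOf n w (b + 1) ≠ none)
    (hne : blockVal n (fun i => (w i).2) b ≠ blockVal n (fun i => (w i).2) (b + 1)) :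
    ∃ t, b ≤ t ∧ ((n + 1 : ℕ) : ℕ∞) ≤ (automaton n).maxCostOfResponse w t := by
  obtain ⟨k, hk, hbit⟩ : ∃ k < n + 1,
      (w (b * (n + 1) + k)).2 ≠ (w ((b + 1) * (n + 1) + k)).2 := by
    by_contra! hcon
    apply hne
    have key : ∀ k ≤ n + 1, prefixVal (fun i => (w i).2) (b * (n + 1)) k =
        prefixVal (fun i => (w i).2) ((b + 1) * (n + 1)) k := by
      intro k hk
      induction k with
      | zero => rfl
      | succ k ih =>
        simp only [prefixVal]
        rw [ih (by omega), hcon k (by omega)]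
    exact key _ le_rfl
  refine ⟨b * (n + 1) + k + 1, by nlinarith, ?_⟩
  refine le_trans (le_costOfResponse _ (request_of_active hk h) ?_) (costOfResponse_le_max _ _ _ _)
  intro u hu hr
  obtain ⟨c, rfl, hc, hpar, hr⟩ := exists_block_of_response hk hu hr
  -- The next block is active and carries the wrong bit, so the response is at least two blocks
  -- away. This costs `2 * n`, which exceeds `n` because `n` is positive.
  have hc1 : c ≠ b + 1 := by
    rintro rfl
    rcases hr with hr | hr
    · exact h' hr
    · exact hbit hr.symm
  rw [Nat.cast_le]
  have h1 : (b + 2) * (n + 1) ≤ c * (n + 1) := Nat.mul_le_mul_right _ (by omega)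
  have h2 : (b + 2) * (n + 1) = b * (n + 1) + (n + 1) + (n + 1) := by ring
  have h3 := segmentCost_add (automaton n) w
    (some (⟨k, hk⟩, (w (b * (n + 1) + k)).2, b.bodd))
    (t := b * (n + 1) + k + 1) (u := b * (n + 1) + k + 1 + (n + 1))
    (v := b * (n + 1) + k + 1 + (n + 1) + (n + 1)) (by omega) (by omega)
  rw [segmentCost_block, segmentCost_block] at h3
  have h4 := segmentCost_mono (automaton n) w
    (some (⟨k, hk⟩, (w (b * (n + 1) + k)).2, b.bodd)) (t := b * (n + 1) + k + 1)
    (show b * (n + 1) + k + 1 + (n + 1) + (n + 1) ≤ c * (n + 1) + k + 1 by omega)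
  omega

theorem le_runCost_of_frequently {Q S J : Type} (M : StreettAutomaton Q S J) {w : ℕ → S} {c : ℕ∞}
    (h : ∀ b, ∃ t, b ≤ t ∧ c ≤ M.maxCostOfResponse w t) : c ≤ M.runCost w :=
  Filter.le_limsup_of_frequently_le (frequently_atTop.2 fun b => by simpa using h b)

/-- In a run of finite cost, the automaton becomes idle infinitely often. -/
theorem exists_idle_of_mem_language {n : ℕ} {w : ℕ → (Bool × Bool) × Bool}
    (h : w ∈ (automaton n).language) (b : ℕ) : ∃ c, b ≤ c ∧ modeOf n w c = none := by
  by_contra! hcon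
  refine not_le.2 h (le_runCost_of_frequently _ fun t => ?_)
  obtain ⟨c, k, hk, hck⟩ := exists_block n (b * (n + 1) + t)
  have active : ∀ u, b * (n + 1) + t + 1 ≤ u → ((automaton n).run w u).mode ≠ none := by
    intro u hu
    obtain ⟨v, rfl⟩ : ∃ v, u = v + 1 := ⟨u - 1, by omega⟩
    obtain ⟨c, k, hk, rfl⟩ := exists_block n v
    rw [run_automaton n w c k hk]
    apply hcon
    by_contra! hlt
    have : (c + 1) * (n + 1) ≤ b * (n + 1) := Nat.mul_le_mul_right _ hlt
    rw [Nat.succ_mul] at this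
    omega
  refine ⟨b * (n + 1) + t + 1, by omega, ?_⟩
  -- The request of the pair `none` is never answered from here on, so its cost is an infimum over
  -- the empty set.
  refine le_trans (le_costOfResponse (automaton n) (j := none) (active _ le_rfl) ?_) (costOfResponse_le_max _ _ _ _)
  intro u hu hr
  exact absurd hr (active u hu)

/-- Runs that become idle infinitely often and in which the claimed number never changes in the
middle of an active phase have cost at most `n`. -/
theorem runCost_le {n : ℕ} {w : ℕ → (Bool × Bool) × Bool}
    (hidle : ∀ b, ∃ c, b ≤ c ∧ modeOf n w c = none)
    (hbit : ∀ b, modeOf n w b ≠ none → modeOf n w (b + 1) ≠ none →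
      ∀ k < n + 1, (w (b * (n + 1) + k)).2 = (w ((b + 1) * (n + 1) + k)).2) :
    (automaton n).runCost w ≤ n := by
  refine Filter.limsup_le_of_le (h := ?_)
  -- Position `0` is dropped because the initial state belongs to no block.
  filter_upwards [eventually_ge_atTop 1] with u hu
  obtain ⟨t, rfl⟩ : ∃ t, u = t + 1 := ⟨u - 1, by omega⟩
  obtain ⟨b, k, hk, rfl⟩ := exists_block n t
  refine iSup_le ?_
  rintro (_ | ⟨l, v, p⟩)
  · obtain ⟨c, hc, hm⟩ := hidle b
    have hc' : b * (n + 1) ≤ c * (n + 1) := Nat.mul_le_mul_right _ hc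
    refine (costOfResponse_le _ (u := c * (n + 1) + k + 1) (by omega) ?_).trans ?_
    · rw [run_automaton n w c k hk]
      exact hm
    · simp [StreettAutomaton.segmentCost, automaton, CostLabel.val]
  · by_cases hreq : (automaton n).run w (b * (n + 1) + k + 1) ∈
        (automaton n).request (some (l, v, p))
    · have hreq' := hreq
      rw [run_automaton n w b k hk] at hreq'
      simp only [automaton, Set.mem_ofPred_eq] at hreq'
      obtain ⟨rfl, rfl, rfl, hact⟩ := hreq'
      refine (costOfResponse_le _ (u := b * (n + 1) + k + 1 + (n + 1)) (by omega) ?_).trans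
        (Nat.cast_le.2 (segmentCost_block n w _ _).le)
      have : b * (n + 1) + k + 1 + (n + 1) = (b + 1) * (n + 1) + k + 1 := by ring
      rw [this, run_automaton n w (b + 1) k hk]
      refine ⟨rfl, by simp, ?_⟩
      by_cases h1 : modeOf n w (b + 1) = none
      · exact .inl h1
      · exact .inr (hbit b hact h1 k hk).symm
    · rw [StreettAutomaton.costOfResponse, if_neg hreq]
      exact zero_le

/-! ### Bad pairs -/

/-- The sequence `X` has a bad `j`-pair between `a` and `b`: two occurrences of `j` without a larger
number in between. -/
def IsBadPair (X : ℕ → ℕ) (j a b : ℕ) : Prop :=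
  a < b ∧ X a = j ∧ X b = j ∧ ∀ r, a < r → r < b → X r ≤ j

/-- Every sequence of `2 ^ K` numbers smaller than `K` has a bad pair. -/
theorem exists_isBadPair (K : ℕ) (X : ℕ → ℕ) (s : ℕ)
    (h : ∀ r, s ≤ r → r < s + 2 ^ K → X r < K) :
    ∃ j a b, s ≤ a ∧ b < s + 2 ^ K ∧ IsBadPair X j a b := by
  induction K generalizing s with
  | zero => exact absurd (h s le_rfl (by simp)) (by simp)
  | succ K ih =>
    have hpow : 2 ^ (K + 1) = 2 ^ K + 2 ^ K := by ring
    have hpos : 0 < 2 ^ K := by positivity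
    -- If the maximum `K` is absent from the first half, or from the `2 ^ K` entries after one of
    -- its occurrences there, induction applies to that stretch. Otherwise two occurrences of `K`
    -- form a bad pair, as nothing larger exists.
    by_cases h1 : ∀ r, s ≤ r → r < s + 2 ^ K → X r < K
    · obtain ⟨j, a, b, ha, hb, hab⟩ := ih s h1
      exact ⟨j, a, b, ha, by omega, hab⟩
    · push Not at h1
      obtain ⟨a, ha, ha', hKa⟩ := h1
      have hXa : X a = K := by
        have := h a ha (by omega)
        omega
      by_cases h2 : ∀ r, a + 1 ≤ r → r < a + 1 + 2 ^ K → X r < K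
      · obtain ⟨j, c, d, hc, hd, hcd⟩ := ih (a + 1) h2
        exact ⟨j, c, d, by omega, by omega, hcd⟩
      · push Not at h2
        obtain ⟨b, hb, hb', hKb⟩ := h2
        have hXb : X b = K := by
          have := h b (by omega) (by omega)
          omega
        refine ⟨K, a, b, ha, by omega, by omega, hXa, hXb, fun r hr hr' => ?_⟩
        have := h r (by omega) (by omega)
        omega

/-- Between two numbers of the same 2-adic valuation there is one of larger valuation. -/
theorem exists_padicValNat_lt {a b : ℕ} (ha : 0 < a) (hab : a < b)
    (h : padicValNat 2 a = padicValNat 2 b) :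
    ∃ r, a < r ∧ r < b ∧ padicValNat 2 a < padicValNat 2 r := by
  obtain ⟨a', ha'⟩ : 2 ^ padicValNat 2 a ∣ a := pow_padicValNat_dvd
  obtain ⟨b', hb'⟩ : 2 ^ padicValNat 2 a ∣ b := by
    rw [h]
    exact pow_padicValNat_dvd
  have hna : ¬ 2 ^ (padicValNat 2 a + 1) ∣ a := pow_succ_padicValNat_not_dvd (by omega)
  have hnb : ¬ 2 ^ (padicValNat 2 a + 1) ∣ b := by
    rw [h]
    exact pow_succ_padicValNat_not_dvd (by omega)
  generalize padicValNat 2 a = v at *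
  have hpos : 0 < 2 ^ v := by positivity
  have odd_of {x x' : ℕ} (hx : x = 2 ^ v * x') (hn : ¬ 2 ^ (v + 1) ∣ x) : x' % 2 = 1 := by
    by_contra hcon
    apply hn
    rw [hx, pow_succ]
    exact mul_dvd_mul_left _ (by omega)
  have oa := odd_of ha' hna
  have ob := odd_of hb' hnb
  have hlt : a' < b' := by
    rw [ha', hb'] at hab
    exact Nat.lt_of_mul_lt_mul_left hab
  -- Both cofactors are odd, so the even number `a' + 1` lies strictly between them.
  refine ⟨2 ^ v * (a' + 1), ?_, ?_, ?_⟩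
  · rw [ha']
    exact Nat.mul_lt_mul_of_pos_left (by omega) hpos
  · rw [hb']
    exact Nat.mul_lt_mul_of_pos_left (by omega) hpos
  · refine (padicValNat_dvd_iff_le (p := 2) (by positivity)).1 ?_
    rw [pow_succ]
    exact mul_dvd_mul_left _ (by omega)

theorem padicValNat_succ_lt {K i : ℕ} (hi : i + 1 < 2 ^ K) : padicValNat 2 (i + 1) < K := by
  by_contra! h
  have h1 : 2 ^ K ∣ i + 1 := (padicValNat_dvd_iff_le (p := 2) (by omega)).2 h
  exact absurd (Nat.le_of_dvd (by omega) h1) (by omega)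

/-! ### Epochs -/

/-- A bad `j`-pair ends every epoch in which Player O claims `j`. -/
theorem exists_idle_of_isBadPair {X Y : ℕ → ℕ} {S : ℕ → Bool} {j a b : ℕ}
    (hY : ∀ c, a ≤ c → c ≤ b → Y c = j) (hX : IsBadPair X j a b) :
    ∃ c, a ≤ c ∧ c ≤ b + 1 ∧ modes X Y S c = none := by
  by_contra! hcon
  obtain ⟨hab, ha, hb, hr⟩ := hX
  have key : ∀ c, a + 1 ≤ c → c ≤ b → modes X Y S c = some true := by
    intro c hc
    induction c, hc using Nat.le_induction with
    | base =>
      intro _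
      have h1 := hcon a le_rfl (by omega)
      have h2 := hcon (a + 1) (by omega) (by omega)
      rw [modes, compare_eq_iff_eq.2 (ha.trans (hY a le_rfl hab.le).symm)] at h2 ⊢
      rcases h : modes X Y S a with _ | _ | _
      · exact absurd h h1
      · rfl
      · simp [h, nextMode] at h2
    | succ c hc ih =>
      intro hcb
      have h2 := hcon (c + 1) (by omega) (by omega)
      rw [modes, ih (by omega)] at h2 ⊢
      rcases (hr c (by omega) (by omega)).lt_or_eq with h | h
      · rw [compare_lt_iff_lt.2 (h.trans_eq (hY c (by omega) (by omega)).symm)]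
        rfl
      · rw [compare_eq_iff_eq.2 (h.trans (hY c (by omega) (by omega)).symm)] at h2
        simp [nextMode] at h2
  apply hcon (b + 1) (by omega) le_rfl
  rw [modes, key b hab le_rfl, compare_eq_iff_eq.2 (hb.trans (hY b hab.le le_rfl).symm)]
  rfl

/-- Without bad `j`-pairs, an epoch in which Player O claims `j` does not end. -/
theorem active_of_not_isBadPair {X Y : ℕ → ℕ} {S : ℕ → Bool} {j s e : ℕ} (hse : s ≤ e)
    (hstart : modes X Y S s = some false) (hY : Y s = j)
    (hkeep : ∀ c, s ≤ c → c < e → modes X Y S c ≠ none → modes X Y S (c + 1) ≠ none →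
      Y c = Y (c + 1))
    (hX : ∀ a b, s ≤ a → ¬ IsBadPair X j a b) : modes X Y S e ≠ none := by
  -- The invariant: the claim is still `j`, and a true `seen` is witnessed by an occurrence of `j`
  -- since `s` with nothing larger after it. A second occurrence would complete a bad pair.
  have key : ∀ c, s ≤ c → c ≤ e → Y c = j ∧ ∃ seen, modes X Y S c = some seen ∧
      (seen = true → ∃ a, s ≤ a ∧ a < c ∧ X a = j ∧ ∀ r, a < r → r < c → X r ≤ j) := by
    intro c hc
    induction c, hc using Nat.le_induction with
    | base => exact fun _ => ⟨hY, false, hstart, by simp⟩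
    | succ c hc ih =>
      intro hce
      obtain ⟨hYc, seen, hm, hseen⟩ := ih (by omega)
      have hmode : ∃ seen, modes X Y S (c + 1) = some seen ∧ (seen = true →
          ∃ a, s ≤ a ∧ a < c + 1 ∧ X a = j ∧ ∀ r, a < r → r < c + 1 → X r ≤ j) := by
        rw [modes, hm, hYc]
        rcases lt_trichotomy (X c) j with h | h | h
        · rw [compare_lt_iff_lt.2 h]
          refine ⟨seen, by cases seen <;> rfl, fun hs => ?_⟩
          obtain ⟨a, ha, hac, hXa, hr⟩ := hseen hs
          refine ⟨a, ha, by omega, hXa, fun r h1 h2 => ?_⟩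
          rcases Nat.lt_succ_iff_lt_or_eq.1 h2 with h3 | rfl
          · exact hr r h1 h3
          · exact h.le
        · rw [compare_eq_iff_eq.2 h]
          cases seen with
          | false => exact ⟨true, rfl, fun _ => ⟨c, hc, by omega, h, fun r h1 h2 => by omega⟩⟩
          | true =>
            obtain ⟨a, ha, hac, hXa, hr⟩ := hseen rfl
            exact absurd ⟨hac, hXa, h, hr⟩ (hX a c ha)
        · rw [compare_gt_iff_gt.2 h]
          exact ⟨false, by cases seen <;> rfl, by simp⟩
      obtain ⟨seen', hm', hseen'⟩ := hmode
      refine ⟨?_, seen', hm', hseen'⟩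
      rw [← hkeep c hc (by omega) (by simp [hm]) (by simp [hm']), hYc]
  obtain ⟨-, seen, hm, -⟩ := key e hse le_rfl
  simp [hm]

theorem idle_of_no_start {X Y : ℕ → ℕ} {S : ℕ → Bool} {s e : ℕ} (hse : s ≤ e)
    (h : modes X Y S s = none) (hS : ∀ c, s < c → c ≤ e → S c = false) :
    modes X Y S e = none := by
  induction e, hse using Nat.le_induction with
  | base => exact h
  | succ e hse ih =>
    rw [modes, ih fun c h1 h2 => hS c h1 (by omega), hS (e + 1) (by omega) le_rfl]
    rfl

/-! ### Insufficient lookahead -/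

section Lookahead

variable {K : ℕ} (Y : (ℕ → Fin K × Bool) → ℕ → ℕ)

/-- The mode in the block `b` if Player I plays the numbers and start signals `P` and Player O
answers with the numbers `Y P`. -/
def playMode (P : ℕ → Fin K × Bool) (b : ℕ) : Option Bool :=
  modes (fun c => (P c).1) (Y P) (fun c => (P c).2) b

/-- Player O changes her claim between the blocks `b` and `b + 1` of an epoch. -/
def ClaimChange (P : ℕ → Fin K × Bool) (b : ℕ) : Prop :=
  playMode Y P b ≠ none ∧ playMode Y P (b + 1) ≠ none ∧ Y P b ≠ Y P (b + 1)

variable {Y} {M : ℕ} (hM : 0 < M) (hMK : M < 2 ^ K) (hK : 2 ≤ K)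
  (hcausal : ∀ P P' b, (∀ c < b + M, P c = P' c) → Y P b = Y P' b)

include hM hcausal in
theorem playMode_congr {P P' : ℕ → Fin K × Bool} {b : ℕ} (h : ∀ c < b + M, P c = P' c) :
    playMode Y P b = playMode Y P' b :=
  modes_congr (fun c hc => by rw [h c (by omega)])
    (fun c hc => hcausal _ _ _ fun d hd => h d (by omega)) (fun c hc => by rw [h c (by omega)])

variable (hidle : ∀ P b, ∃ c, b ≤ c ∧ playMode Y P c = none)

include hM hMK hK hcausal hidle in
/-- Player I can continue every finite play such that Player O has to change her claim. -/
theorem exists_forced_claimChange (P : ℕ → Fin K × Bool) (s : ℕ) :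
    ∃ (P' : ℕ → Fin K × Bool) (s' : ℕ), s < s' ∧ (∀ c < s, P' c = P c) ∧
      ∀ P'' : ℕ → Fin K × Bool, (∀ c < s', P'' c = P' c) → ∃ b, s ≤ b ∧ ClaimChange Y P'' b := by
  let z : Fin K := ⟨0, by omega⟩
  let P₁ : ℕ → Fin K × Bool := fun c => if c < s then P c else (z, false)
  obtain ⟨e, hse, he⟩ := hidle P₁ s
  -- The mode at `e` is determined by the blocks before `e + M`. Starting only after these keeps `e`
  -- idle whatever is played from `t` on.
  let t := e + M + 1
  let ruler : ℕ → Fin K := fun i =>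
    if h : padicValNat 2 (i + 1) < K then ⟨padicValNat 2 (i + 1), h⟩ else z
  let R : Fin K → ℕ → Fin K × Bool := fun x c =>
    if c < t then P₁ c else if c < t + M then (ruler (c - t), decide (c = t)) else (x, false)
  -- The claim at `t` depends only on the blocks before `t + M`, where all `R x` agree. So the tail
  -- `x` may be chosen after `j`, and different from it.
  let j := Y (R z) t
  let x : Fin K := if j = 0 then ⟨1, by omega⟩ else z
  have hx : (x : ℕ) ≠ j := by
    by_cases h : j = 0 <;> simp [x, z, h, Ne.symm]
  have hYt : Y (R x) t = j := hcausal _ _ _ fun c hc => by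
    by_cases h : c < t <;> simp [R, h, hc]
  have hsig : ∀ c, s ≤ c → c ≠ t → (R x c).2 = false := by
    intro c hc hct
    simp only [R, P₁]
    split_ifs <;> first | omega | simp [hct]
  have hstart : playMode Y (R x) t = some false := by
    have h1 : playMode Y (R x) e = none := by
      rw [← he]
      exact playMode_congr hM hcausal fun c hc => if_pos (by omega)
    have h2 : playMode Y (R x) (e + M) = none :=
      idle_of_no_start (by omega) h1 fun c h1 h2 => hsig c (by omega) (by omega)
    have h3 : (R x t).2 = true := by simp [R, hM]
    unfold playMode at h2 ⊢
    change modes _ _ _ (e + M + 1) = _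
    rw [modes, h2]
    change nextMode _ _ (R x t).2 = _
    rw [h3]
    rfl
  have hgood : ∀ a b, t ≤ a → ¬ IsBadPair (fun c => ((R x c).1 : ℕ)) j a b := by
    rintro a b hta ⟨hab, ha, hb, hr⟩
    beta_reduce at ha hb hr
    have hruler : ∀ i, t ≤ i → i < t + M → ((R x i).1 : ℕ) = padicValNat 2 (i - t + 1) := by
      intro i h1 h2
      have h3 : padicValNat 2 (i - t + 1) < K := padicValNat_succ_lt (by omega)
      simp [R, h1.not_gt, h2, ruler, h3]
    by_cases hbM : b < t + M
    · rw [hruler a hta (by omega)] at ha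
      rw [hruler b (by omega) hbM] at hb
      obtain ⟨r, h1, h2, h3⟩ := exists_padicValNat_lt (a := a - t + 1) (b := b - t + 1)
        (by omega) (by omega) (ha.trans hb.symm)
      have h4 := hr (r - 1 + t) (by omega) (by omega)
      rw [hruler _ (by omega) (by omega)] at h4
      have h5 : r - 1 + t - t + 1 = r := by omega
      rw [h5] at h4
      omega
    · apply hx
      rw [← hb]
      simp [R, hbM, show ¬ b < t by omega]
  obtain ⟨e', hte, he'⟩ := hidle (R x) t
  obtain ⟨b, htb, hbe, hchange⟩ : ∃ b, t ≤ b ∧ b < e' ∧ ClaimChange Y (R x) b := by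
    by_contra! hcon
    refine active_of_not_isBadPair hte hstart hYt (fun c h1 h2 h3 h4 => ?_) hgood he'
    by_contra h5
    exact hcon c h1 h2 ⟨h3, h4, h5⟩
  -- The claim change happens before `e'`, so the blocks before `e' + M` already enforce it.
  refine ⟨R x, e' + M, by omega, fun c hc => ?_, fun P'' h => ⟨b, by omega, ?_⟩⟩
  · simp [R, P₁, hc, show c < t by omega]
  · obtain ⟨h1, h2, h3⟩ := hchange
    refine ⟨?_, ?_, ?_⟩
    · rwa [playMode_congr hM hcausal fun c hc => h c (by omega)]
    · rwa [playMode_congr hM hcausal fun c hc => h c (by omega)]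
    · rwa [hcausal P'' (R x) b fun c hc => h c (by omega),
        hcausal P'' (R x) (b + 1) fun c hc => h c (by omega)]

include hM hMK hK hcausal hidle in
/-- With insufficient lookahead, Player O has to change her claim infinitely often. -/
theorem exists_frequently_claimChange :
    ∃ P, ∀ b, ∃ c, b ≤ c ∧ ClaimChange Y P c := by
  choose! F G hlt hext hforce using exists_forced_claimChange hM hMK hK hcausal hidle
  -- Iterating the forcing step gives plays with growing fixed prefixes. Stage `i` fixes at least
  -- `i` blocks, so entry `c` of the limit can be read off at stage `c + 1`.
  let D : ℕ → (ℕ → Fin K × Bool) × ℕ := fun i =>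
    Nat.rec ((fun _ => (⟨0, by omega⟩, false)), 0) (fun _ d => (F d.1 d.2, G d.1 d.2)) i
  have hD (i : ℕ) : D (i + 1) = (F (D i).1 (D i).2, G (D i).1 (D i).2) := rfl
  have hmono : StrictMono fun i => (D i).2 :=
    strictMono_nat_of_lt_succ fun i => by rw [hD]; exact hlt _ _
  have hstable : ∀ i k, i ≤ k → ∀ c < (D i).2, (D k).1 c = (D i).1 c := by
    intro i k hik
    induction k, hik using Nat.le_induction with
    | base => exact fun _ _ => rfl
    | succ k hik ih =>
      intro c hc
      rw [hD, ← ih c hc]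
      exact hext _ _ c (hc.trans_le (hmono.monotone hik))
  have hid : ∀ i, i ≤ (D i).2 := fun _ => hmono.le_apply
  refine ⟨fun c => (D (c + 1)).1 c, fun i => ?_⟩
  obtain ⟨b, hb, h⟩ := hforce (D i).1 (D i).2 (fun c => (D (c + 1)).1 c) fun c hc => by
    change c < (D (i + 1)).2 at hc
    change _ = (D (i + 1)).1 c
    rcases le_total (c + 1) (i + 1) with h | h
    · exact (hstable _ _ h c (hid (c + 1))).symm
    · exact hstable _ _ h c hc
  exact ⟨b, (hid i).trans hb, h⟩

end Lookahead

/-- The outcome of the strategy `τ` against the input `α`. -/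
def play {A B : Type} (f : ℕ → ℕ) (τ : List A → B) (α : ℕ → A) (i : ℕ) : A × B :=
  (α i, τ (inputUpTo f α i))

theorem play_mem_outcomes {A B : Type} (f : ℕ → ℕ) (τ : List A → B) (α : ℕ → A) :
    play f τ α ∈ outcomes f τ := fun _ => rfl

theorem runCost_play_le {A B Q J : Type} (M : StreettAutomaton Q (A × B) J) (f : ℕ → ℕ)
    (τ : List A → B) (α : ℕ → A) : M.runCost (play f τ α) ≤ strategyCost M f τ :=
  le_iSup₂ (f := fun w _ => M.runCost w) _ (play_mem_outcomes f τ α)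

/-- Every strategy has cost at least `n`. -/
theorem le_strategyCost (n : ℕ) (f : ℕ → ℕ) (τ : List (Bool × Bool) → Bool) :
    n ≤ strategyCost (automaton n) f τ := by
  refine le_trans (le_runCost_of_frequently _ fun b => ?_)
    (runCost_play_le (automaton n) f τ fun _ => (false, true))
  set w := play f τ fun _ => (false, true)
  obtain ⟨c, hc, h⟩ : ∃ c, b ≤ c ∧ modeOf n w c ≠ none := by
    -- The start signal is always set, so an idle block is followed by an active one.
    by_cases h : modeOf n w b = none
    · refine ⟨b + 1, by omega, ?_⟩
      unfold modeOf at h ⊢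
      rw [modes, h]
      simp [w, play, nextMode]
    · exact ⟨b, le_rfl, h⟩
  exact ⟨_, by nlinarith, le_maxCost_of_active h⟩

/-! ### The lower bound on the lookahead -/

theorem inputUpTo_congr {A : Type} {f : ℕ → ℕ} {α α' : ℕ → A} {i : ℕ}
    (h : ∀ k < ∑ i' ∈ Finset.range (i + 1), f i', α k = α' k) :
    inputUpTo f α i = inputUpTo f α' i :=
  congrArg List.ofFn (funext fun k => h k k.2)

theorem sum_lt_of_not_eventuallyGrants {f : ℕ → ℕ} (hf : IsDelayFunction f) {m : ℕ}
    (h : ¬ EventuallyGrants f m) (i : ℕ) : ∑ i' ∈ Finset.range (i + 1), f i' < i + 1 + m := by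
  have h1 : ∑ i' ∈ Finset.range (i + 1), (f i' - 1) < m := by
    by_contra! hcon
    exact h ⟨i, hcon⟩
  have h2 : ∑ i' ∈ Finset.range (i + 1), f i' =
      ∑ i' ∈ Finset.range (i + 1), (f i' - 1) + (i + 1) := by
    rw [Finset.sum_congr rfl fun j _ => (Nat.sub_add_cancel (hf j)).symm, Finset.sum_add_distrib]
    simp
  omega

/-- The input word encoding the numbers and start signals `P`. -/
def inputWord (n : ℕ) (P : ℕ → Fin (2 ^ (n + 1)) × Bool) (i : ℕ) : Bool × Bool :=
  (encode n (fun b => (P b).1) i, (P (i / (n + 1))).2)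

theorem eventuallyGrants_of_strategyCost_eq {n : ℕ} (hn : 0 < n) {f : ℕ → ℕ}
    {τ : List (Bool × Bool) → Bool} (hf : IsDelayFunction f)
    (hwin : IsWinningO f (automaton n).language τ) (hcost : strategyCost (automaton n) f τ = n) :
    EventuallyGrants f (n * (2 ^ 2 ^ n - 1)) := by
  by_contra hgrant
  let w (P : ℕ → Fin (2 ^ (n + 1)) × Bool) : ℕ → (Bool × Bool) × Bool := play f τ (inputWord n P)
  let Y (P : ℕ → Fin (2 ^ (n + 1)) × Bool) : ℕ → ℕ := blockVal n fun i => (w P i).2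
  have hmode (P b) : modeOf n (w P) b = playMode Y P b := by
    refine modes_congr (fun c _ => ?_) (fun _ _ => rfl) fun c _ => ?_
    · exact blockVal_encode (v := fun b => (P b).1) (P c).1.2
    · simp [w, play, inputWord]
  -- With `M = 2 ^ 2 ^ n`, the last bit of block `b` is chosen after fewer than `(b + 1) * (n + 1) +
  -- n * (M - 1)` input letters, which is at most `(b + M) * (n + 1)`.
  have hcausal : ∀ P P' b, (∀ c < b + 2 ^ 2 ^ n, P c = P' c) → Y P b = Y P' b := by
    intro P P' b h
    refine blockVal_congr fun i hi => congrArg τ (inputUpTo_congr fun k hk => ?_)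
    have h1 := sum_lt_of_not_eventuallyGrants hf hgrant i
    have h2 : k / (n + 1) < b + 2 ^ 2 ^ n := by
      rw [Nat.div_lt_iff_lt_mul (by omega)]
      have h3 : 0 < 2 ^ 2 ^ n := by positivity
      generalize 2 ^ 2 ^ n = M at *
      obtain ⟨M, rfl⟩ : ∃ M', M = M' + 1 := ⟨M - 1, by omega⟩
      simp only [Nat.add_sub_cancel] at h1
      nlinarith
    simp only [inputWord, encode, h _ h2]
  have hpow : 2 ^ n < 2 ^ (n + 1) := Nat.pow_lt_pow_right (by omega) (by omega)
  obtain ⟨P, hP⟩ := exists_frequently_claimChange (Y := Y) (M := 2 ^ 2 ^ n) (by positivity)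
    (Nat.pow_lt_pow_right (by omega) hpow) (Nat.le_self_pow (by omega) 2) hcausal fun P b => by
      obtain ⟨c, hc, h⟩ := exists_idle_of_mem_language (hwin _ (play_mem_outcomes f τ _)) b
      exact ⟨c, hc, hmode P c ▸ h⟩
  have h1 : ((n + 1 : ℕ) : ℕ∞) ≤ (automaton n).runCost (w P) := by
    refine le_runCost_of_frequently _ fun b => ?_
    obtain ⟨c, hc, h1, h2, h3⟩ := hP b
    rw [← hmode] at h1 h2
    obtain ⟨t, ht, h⟩ := lt_maxCost_of_change hn h1 h2 h3
    exact ⟨t, by omega, h⟩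
  have h2 := h1.trans ((runCost_play_le _ f τ _).trans hcost.le)
  rw [Nat.cast_le] at h2
  omega

/-! ### An optimal strategy with large lookahead -/

section Optimal

variable (K : ℕ)

open Classical in
/-- A number `j` that has a bad pair among the first `2 ^ K` numbers of `g`. -/
noncomputable def chooseClaim (g : ℕ → ℕ) : ℕ :=
  if h : ∃ j a b, b < 2 ^ K ∧ IsBadPair g j a b then h.choose else 0

/-- The claim of Player O in the block `b`, chosen from the next `2 ^ K` numbers. -/
noncomputable def claim (X : ℕ → ℕ) (b : ℕ) : ℕ :=
  chooseClaim K fun r => if r < 2 ^ K then X (b + r) else 0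

/-- The mode and the claim in each block, if Player O keeps her claim until the epoch ends. -/
noncomputable def plan (X : ℕ → ℕ) (S : ℕ → Bool) : ℕ → Option Bool × ℕ
  | 0 => (nextMode none .eq (S 0), claim K X 0)
  | b + 1 => (nextMode (plan X S b).1 (compare (X b) (plan X S b).2) (S (b + 1)),
      if (plan X S b).1 = none then claim K X (b + 1) else (plan X S b).2)

variable {K} {X X' : ℕ → ℕ} {S S' : ℕ → Bool}

theorem claim_spec (hX : ∀ c, X c < K) (b : ℕ) :
    ∃ a c, b ≤ a ∧ IsBadPair X (claim K X b) a c := by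
  have h : ∃ j a c, c < 2 ^ K ∧
      IsBadPair (fun r => if r < 2 ^ K then X (b + r) else 0) j a c := by
    obtain ⟨j, a, c, ha, hc, h⟩ := exists_isBadPair K
      (fun r => if r < 2 ^ K then X (b + r) else 0) 0 fun r _ hr => by
        rw [zero_add] at hr
        simp [hr, hX]
    exact ⟨j, a, c, by omega, h⟩
  obtain ⟨a, c, hc, hac, h1, h2, h3⟩ := h.choose_spec
  have hj : claim K X b = h.choose := dif_pos h
  rw [← hj] at h1 h2 h3
  beta_reduce at h1 h2 h3
  refine ⟨b + a, b + c, by omega, by omega, ?_, ?_, fun r hr hr' => ?_⟩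
  · rwa [if_pos (by omega)] at h1
  · rwa [if_pos (by omega)] at h2
  · have h4 := h3 (r - b) (by omega) (by omega)
    rwa [if_pos (by omega), show b + (r - b) = r by omega] at h4

theorem claim_congr {b : ℕ} (h : ∀ c < b + 2 ^ K, X c = X' c) : claim K X b = claim K X' b := by
  refine congrArg _ (funext fun r => ?_)
  split_ifs with hr
  · exact h _ (by omega)
  · rfl

/-- This is what makes the plan playable: it looks fewer than `2 ^ K` blocks beyond the current one.
-/
theorem plan_congr {b : ℕ} (hX : ∀ c < b + 2 ^ K, X c = X' c) (hS : ∀ c ≤ b, S c = S' c) :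
    plan K X S b = plan K X' S' b := by
  induction b with
  | zero => rw [plan, plan, claim_congr hX, hS 0 le_rfl]
  | succ b ih =>
    have hpos : 0 < 2 ^ K := by positivity
    rw [plan, plan, ih (fun c hc => hX c (by omega)) fun c hc => hS c (by omega), claim_congr hX,
      hS _ le_rfl, hX b (by omega)]

theorem plan_lt (hX : ∀ c, X c < K) (b : ℕ) : (plan K X S b).2 < K := by
  have hclaim (b) : claim K X b < K := by
    obtain ⟨a, c, -, -, h, -⟩ := claim_spec hX b
    exact h ▸ hX a
  induction b with
  | zero => exact hclaim 0
  | succ b ih =>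
    rw [plan]
    dsimp only
    split_ifs
    · exact hclaim _
    · exact ih

/-- Player O simulates the automaton on her own claims, so she knows when an epoch is over. -/
theorem modes_plan (b : ℕ) : modes X (fun c => (plan K X S c).2) S b = (plan K X S b).1 := by
  induction b with
  | zero => rfl
  | succ b ih => rw [modes, ih, plan]

theorem plan_idle (hX : ∀ c, X c < K) (b : ℕ) : ∃ c, b ≤ c ∧ (plan K X S c).1 = none := by
  by_contra! hcon
  -- The claim at the beginning of the epoch may lie before `b`, so the epoch is traced back.
  have key : ∀ s, (∀ c, s ≤ c → (plan K X S c).1 ≠ none) →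
      (plan K X S s).2 = claim K X s → False := by
    intro s hs hclaim
    have hconst : ∀ c, s ≤ c → (plan K X S c).2 = claim K X s := by
      intro c hc
      induction c, hc using Nat.le_induction with
      | base => exact hclaim
      | succ c hc ih =>
        rw [plan]
        simpa [hs c hc] using ih
    obtain ⟨a, c, hsa, hac⟩ := claim_spec hX s
    obtain ⟨d, hd, -, h⟩ := exists_idle_of_isBadPair (Y := fun c => (plan K X S c).2) (S := S)
      (fun d hd _ => hconst d (by omega)) hac
    exact hs d (by omega) (modes_plan d ▸ h)
  induction b with
  | zero => exact key 0 hcon rfl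
  | succ b ih =>
    by_cases h : (plan K X S b).1 = none
    · refine key (b + 1) hcon ?_
      rw [plan]
      simp [h]
    · refine ih fun c hc => ?_
      rcases hc.lt_or_eq with hc | rfl
      · exact hcon c hc
      · exact h

end Optimal

/-- The output of Player O on the input `α`, if she keeps her claim until the epoch ends. -/
noncomputable def plannedOutput (n : ℕ) (α : ℕ → Bool × Bool) : ℕ → Bool :=
  encode n fun b => (plan (2 ^ (n + 1)) (blockVal n fun i => (α i).1)
    (fun c => (α (c * (n + 1))).2) b).2

/-- Position `i` lies in block `i / (n + 1)`, and rounding down to the start of that block keeps all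
the blocks consulted within the bound. -/
theorem plannedOutput_congr {n : ℕ} {α α' : ℕ → Bool × Bool} {i : ℕ}
    (h : ∀ k < 2 ^ 2 ^ (n + 1) * (n + 1) + i, α k = α' k) :
    plannedOutput n α i = plannedOutput n α' i := by
  have hdiv : i / (n + 1) * (n + 1) ≤ i := Nat.div_mul_le_self _ _
  have hpos : 0 < 2 ^ 2 ^ (n + 1) * (n + 1) := by positivity
  unfold plannedOutput encode
  beta_reduce
  rw [plan_congr]
  · intro c hc
    refine blockVal_congr fun k hk => ?_
    have : (c + 1) * (n + 1) ≤ (i / (n + 1) + 2 ^ 2 ^ (n + 1)) * (n + 1) :=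
      Nat.mul_le_mul_right _ hc
    rw [add_mul (i / (n + 1))] at this
    rw [h k (by omega)]
  · intro c hc
    have : c * (n + 1) ≤ i / (n + 1) * (n + 1) := Nat.mul_le_mul_right _ hc
    rw [h _ (by omega)]

theorem exists_optimal (n : ℕ) : ∃ (f : ℕ → ℕ) (τ : List (Bool × Bool) → Bool),
    IsDelayFunction f ∧ IsWinningO f (automaton n).language τ ∧
      strategyCost (automaton n) f τ = n := by
  let L := 2 ^ 2 ^ (n + 1) * (n + 1)
  have hL : 0 < L := by positivity
  let f : ℕ → ℕ := fun i => if i = 0 then L else 1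
  -- In round `i` the available input has length `L + i`, so the round is recovered from the length.
  -- The default letter is never consulted.
  let τ : List (Bool × Bool) → Bool := fun l =>
    plannedOutput n (fun i => l.getD i (false, false)) (l.length - L)
  have hf : IsDelayFunction f := fun i => by
    simp only [f]
    split_ifs <;> omega
  have hsum (i : ℕ) : ∑ i' ∈ Finset.range (i + 1), f i' = L + i := by
    rw [Finset.sum_range_succ']
    simp [f, add_comm]
  have hout : ∀ w ∈ outcomes f τ, ∀ i, (w i).2 = plannedOutput n (fun k => (w k).1) i := by
    intro w hw i
    rw [hw i]
    simp only [τ, inputUpTo, List.length_ofFn, hsum, Nat.add_sub_cancel_left]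
    refine plannedOutput_congr fun k hk => ?_
    rw [List.getD_eq_getElem _ _ (by simpa [hsum] using hk)]
    simp
  have hcost : ∀ w ∈ outcomes f τ, (automaton n).runCost w ≤ n := by
    intro w hw
    have hX (c) := blockVal_lt n (fun i => (w i).1.1) c
    let p := plan (2 ^ (n + 1)) (blockVal n fun i => (w i).1.1) fun c => (w (c * (n + 1))).1.2
    have hY : (blockVal n fun i => (w i).2) = fun b => (p b).2 := by
      funext b
      rw [funext (hout w hw)]
      exact blockVal_encode (v := fun b => (p b).2) (plan_lt hX b)
    have hmode (b) : modeOf n w b = (p b).1 := by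
      rw [modeOf, hY]
      exact modes_plan b
    refine runCost_le (fun b => ?_) fun b h _ k hk => ?_
    · simp only [hmode]
      exact plan_idle hX b
    · rw [hmode] at h
      -- The plan revises its claim only directly after an idle block.
      have hp : (p (b + 1)).2 = (p b).2 := if_neg h
      have hpos (b) : (w (b * (n + 1) + k)).2 = (p b).2.testBit (n - k) := by
        rw [hout w hw, plannedOutput, encode]
        have h1 : (b * (n + 1) + k) / (n + 1) = b := by
          rw [mul_comm, Nat.mul_add_div (by omega), Nat.div_eq_of_lt hk, add_zero]
        have h2 : (b * (n + 1) + k) % (n + 1) = k := by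
          rw [mul_comm, Nat.mul_add_mod, Nat.mod_eq_of_lt hk]
        rw [h1, h2]
      rw [hpos, hpos, hp]
  refine ⟨f, τ, hf, fun w hw => (hcost w hw).trans_lt (ENat.natCast_lt_top n), ?_⟩
  exact le_antisymm (iSup₂_le hcost) (le_strategyCost n f τ)

end BlockGame

/-- The third conjunct says that `n` is the smallest cost of a winning strategy of Player O over all
delay functions, so that the strategies of cost `n` in the other two are the optimal ones. -/
theorem mainTheorem8 :
    ∃ (A B : Type) (_ : Fintype A) (_ : Fintype B) (p : Polynomial ℕ), ∀ n : ℕ, 0 < n →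
      ∃ (Q J : Type) (_ : Fintype Q) (_ : Fintype J) (M : StreettAutomaton Q (A × B) J),
        M.size ≤ p.eval n ∧
        (∃ (f : ℕ → ℕ) (τ : List A → B),
          IsDelayFunction f ∧ IsWinningO f M.language τ ∧ strategyCost M f τ = n) ∧
        (∀ (f : ℕ → ℕ) (τ : List A → B),
          IsDelayFunction f → IsWinningO f M.language τ → strategyCost M f τ = n →
            EventuallyGrants f (n * (2 ^ 2 ^ n - 1))) ∧
        (∀ (f : ℕ → ℕ) (τ : List A → B),
          IsDelayFunction f → IsWinningO f M.language τ → n ≤ strategyCost M f τ) := by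
  refine ⟨Bool × Bool, Bool, inferInstance, inferInstance, 40 * (Polynomial.X + 1) + 1,
    fun n hn => ⟨BlockGame.BlockState n, Option (Fin (n + 1) × Bool × Bool), inferInstance,
      inferInstance, BlockGame.automaton n, ?_, BlockGame.exists_optimal n, ?_, ?_⟩⟩
  · simpa using BlockGame.size_automaton n
  · exact fun f τ hf hwin hcost => BlockGame.eventuallyGrants_of_strategyCost_eq hn hf hwin hcost
  · exact fun f τ _ _ => BlockGame.le_strategyCost n f τ
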